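/- Let $m\ge 1$ and $n\ge 4$ be integers, and let $K_m\vee P_n$ be the join of the complete graph $K_m$ on $m$ vertices and the path $P_n$ on $n$ vertices, that is, their disjoint union together with all edges joining a vertex of $K_m$ to a vertex of $P_n$. (1) The number of spanning trees of $K_m\vee P_n$ is $$\frac{(m+n)^{m-1}}{2^n\sqrt{m^2+4m}}\left(\left(m+2+\sqrt{m^2+4m}\right)^n-\left(m+2-\sqrt{m^2+4m}\right)^n\right).$$ (2) Suppose $m\ge 2$. Put $$a_n=\frac{1}{\sqrt{m^2+4m}}\left(\left(\frac{m+2+\sqrt{m^2+4m}}{2}\right)^n-\left(\frac{m+2-\sqrt{m^2+4m}}{2}\right)^n\right),$$ $$b_n=e\left(\frac{m+2+\sqrt{m^2+4m}}{2}\right)^n-f\left(\frac{m+2-\sqrt{m^2+4m}}{2}\right)^n,$$ where $$e=\frac{\left(m^2-m-m\sqrt{m^2+4m}-\sqrt{m^2+4m}+2mn\right)\left(m+4-\sqrt{m^2+4m}\right)}{4m^2(m+4)},$$ $$f=\frac{\left(m-m^2-m\sqrt{m^2+4m}-\sqrt{m^2+4m}-2mn\right)\left(m+4+\sqrt{m^2+4m}\right)}{4m^2(m+4)}.$$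 Then $a_n$ and $b_n$ are nonnegative integers and, with $g=\gcd(m+n,a_n,b_n)$, the critical group of $K_m\vee P_n$ is isomorphic to $$\mathbb Z/g\mathbb Z\;\oplus\;\left(\mathbb Z/(m+n)\mathbb Z\right)^{m-2}\;\oplus\;\mathbb Z\Big/\frac{(m+n)a_n}{g}\,\mathbb Z.$$ Here the critical group of a connected graph with vertex set $V$ is $\mathbb Z^{|V|-1}/\operatorname{im}\overline{L}_{uv}$, where $\overline{L}_{uv}$ is the graph's Laplacian matrix with row $u$ and column $v$ deleted and $\operatorname{im}$ is the integer span of the columns; the isomorphism holds for every choice of vertices $u,v$. -/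

import Mathlib

namespace JoinCritical

/-- The join `G ∨ H`: the disjoint union of `G` and `H` together with all edges joining a
vertex of `G` to a vertex of `H`. -/
def graphJoin {V W : Type*} (G : SimpleGraph V) (H : SimpleGraph W) : SimpleGraph (V ⊕ W) :=
  (SimpleGraph.sum G H) ⊔ completeBipartiteGraph V W

/-- The graph `K_m ∨ P_n`. -/
def completeJoinPath (m n : ℕ) : SimpleGraph (Fin m ⊕ Fin n) :=
  graphJoin (SimpleGraph.completeGraph (Fin m)) (SimpleGraph.pathGraph n)

/-- The number of spanning trees of `G`: the number of subgraphs of `G` on the whole vertex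
set that are trees. -/
noncomputable def spanningTreeCount {V : Type*} (G : SimpleGraph V) : ℕ :=
  Set.ncard {T : SimpleGraph V | T ≤ G ∧ T.IsTree}

open Classical in
/-- The Laplacian matrix of `G` over `ℤ` with row `u` and column `v` struck out. -/
noncomputable def reducedLaplacian {V : Type*} [Fintype V] [DecidableEq V]
    (G : SimpleGraph V) (u v : V) : Matrix {x : V // x ≠ u} {y : V // y ≠ v} ℤ :=
  (G.lapMatrix ℤ).submatrix Subtype.val Subtype.val

/-- The critical group of `G`, computed by striking out row `u` and column `v`: the quotient of
`ℤ^(|V|-1)` by the integer span of the columns of the reduced Laplacian. -/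
abbrev CriticalGroup {V : Type*} [Fintype V] [DecidableEq V]
    (G : SimpleGraph V) (u v : V) : Type _ :=
  ({x : V // x ≠ u} → ℤ) ⧸ LinearMap.range (reducedLaplacian G u v).mulVecLin

/-- `√(m² + 4m)`. -/
noncomputable def disc (m : ℕ) : ℝ := √((m : ℝ) ^ 2 + 4 * m)

/-- The parameter `a_n` (which also depends on `m`), in closed form. -/
noncomputable def paramA (m n : ℕ) : ℝ :=
  1 / disc m * (((m + 2 + disc m) / 2) ^ n - ((m + 2 - disc m) / 2) ^ n)

/-- The coefficient `e` of the closed form of `b_n`. -/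
noncomputable def coeffE (m n : ℕ) : ℝ :=
  ((m : ℝ) ^ 2 - m - m * disc m - disc m + 2 * m * n) * (m + 4 - disc m) /
    (4 * (m : ℝ) ^ 2 * (m + 4))

/-- The coefficient `f` of the closed form of `b_n`. -/
noncomputable def coeffF (m n : ℕ) : ℝ :=
  ((m : ℝ) - (m : ℝ) ^ 2 - m * disc m - disc m - 2 * m * n) * (m + 4 + disc m) /
    (4 * (m : ℝ) ^ 2 * (m + 4))

/-- The parameter `b_n` (which also depends on `m`), in closed form. -/
noncomputable def paramB (m n : ℕ) : ℝ :=
  coeffE m n * ((m + 2 + disc m) / 2) ^ n - coeffF m n * ((m + 2 - disc m) / 2) ^ n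

end JoinCritical

/-! The critical group is the universal abelian group receiving a harmonic function that vanishes at
a chosen root (`nonempty_criticalGroup_addEquiv`), so it suffices to describe harmonic functions on
the join. Root at a vertex of `K_m`, let `x_i` be the values on `K_m`, `y` the value at one end of
the path and `d = m y - ∑ x_i`. The path equations force the values `y + S_j d`, with `S` the
partial sums of `a`. The root equation says that all values sum to zero, so what remains is `(m+n)
x_i = 0` and `(m+n) y = (1 - T) d`, with `T = ∑_{j<n} S_j` (`IsHarmonic.completeJoinPath_relations`,
converse `isHarmonic_elim`).

For `m ≥ 2`, eliminating one further `x_i` leaves `m - 2` free summands `ℤ/(m+n)` and the pair `y`,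
`d` with `(m+n) y = (1 - T) d` and `a_n d = 0`. A Bézout identity for `g = gcd(m+n, 1-T)`
diagonalizes this pair into `ℤ/g` and `ℤ/((m+n)a_n/g)`; `exists_bezout_of_gcd` identifies `g` with
`gcd(m+n, a_n, b_n)`.

The tree count is the order of this group, by the matrix tree theorem and the determinant formula
for the index of a lattice. -/

namespace JoinCritical

open Finset Matrix

/-! ### Spanning trees as parent functions, and the matrix tree theorem -/

section MatrixTree

variable {V : Type*} {r : V}

open Classical in
/-- The self-map of `V` that fixes the root `r` and sends every other vertex to its parent. -/
noncomputable def parentMap (f : {x : V // x ≠ r} → V) (v : V) : V :=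
  if h : v ≠ r then f ⟨v, h⟩ else r

/-- Iterating the parent map leads from every vertex to the root. -/
def ReachesRoot (f : {x : V // x ≠ r} → V) : Prop :=
  ∀ v, ∃ k, (parentMap f)^[k] v = r

/-- The graph that joins every vertex other than the root to its parent. -/
def parentGraph (f : {x : V // x ≠ r} → V) : SimpleGraph V :=
  SimpleGraph.fromRel fun a b => parentMap f a = b

@[simp] lemma parentMap_root (f : {x : V // x ≠ r} → V) : parentMap f r = r := by
  simp [parentMap]

lemma parentMap_of_ne (f : {x : V // x ≠ r} → V) (v : {x : V // x ≠ r}) :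
    parentMap f v = f v := by
  simp [parentMap, v.2]

lemma ReachesRoot.parentMap_ne {f : {x : V // x ≠ r} → V} (hf : ReachesRoot f) {v : V}
    (hv : v ≠ r) : parentMap f v ≠ v := by
  intro h
  obtain ⟨k, hk⟩ := hf v
  exact hv ((Function.iterate_fixed h k).symm.trans hk)

lemma ReachesRoot.parentMap_parentMap_ne {f : {x : V // x ≠ r} → V} (hf : ReachesRoot f) {v : V}
    (hv : v ≠ r) : parentMap f (parentMap f v) ≠ v := by
  intro h
  have key : ∀ k, (parentMap f)^[k] v = v ∨ (parentMap f)^[k] v = parentMap f v := by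
    intro k
    induction k with
    | zero => exact Or.inl rfl
    | succ k ih =>
      rw [Function.iterate_succ_apply']
      rcases ih with ih | ih <;> rw [ih]
      · exact Or.inr rfl
      · exact Or.inl h
  obtain ⟨k, hk⟩ := hf v
  rcases key k with h' | h'
  · exact hv (h'.symm.trans hk)
  · rw [← h', hk, parentMap_root] at h
    exact hv h.symm

lemma parentGraph_connected {f : {x : V // x ≠ r} → V} (hf : ReachesRoot f) :
    (parentGraph f).Connected := by
  have step : ∀ v, (parentGraph f).Reachable v (parentMap f v) := by
    intro v
    by_cases h : v = parentMap f v
    · rw [← h]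
    · exact SimpleGraph.Adj.reachable (by simp [parentGraph, h])
  have iter : ∀ k v, (parentGraph f).Reachable v ((parentMap f)^[k] v) := by
    intro k
    induction k with
    | zero => exact fun v => SimpleGraph.Reachable.refl v
    | succ k ih => exact fun v => (step v).trans (ih _)
  have root : ∀ v, (parentGraph f).Reachable v r := by
    intro v
    obtain ⟨k, hk⟩ := hf v
    have := iter k v
    rwa [hk] at this
  exact { preconnected := fun u v => (root u).trans (root v).symm, nonempty := ⟨r⟩ }

/-- Every edge joins some non-root vertex to its parent, so a connected graph arises with at most
`|V| - 1` edges. -/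
lemma parentGraph_isTree [Fintype V] {f : {x : V // x ≠ r} → V} (hf : ReachesRoot f) :
    (parentGraph f).IsTree := by
  classical
  rw [SimpleGraph.isTree_iff_connected_and_card]
  refine ⟨parentGraph_connected hf, le_antisymm ?_
    (parentGraph_connected hf).card_vert_le_card_edgeSet_add_one⟩
  have hsub : (parentGraph f).edgeSet ⊆
      Set.range fun v : {x : V // x ≠ r} => s((v : V), f v) := by
    intro e
    induction e with
    | h a b =>
      rw [SimpleGraph.mem_edgeSet, parentGraph, SimpleGraph.fromRel_adj]
      rintro ⟨hne, h | h⟩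
      · have ha : a ≠ r := by
          rintro rfl
          exact hne ((parentMap_root f).symm.trans h)
        exact ⟨⟨a, ha⟩, by simp only [← parentMap_of_ne f, h]⟩
      · have hb : b ≠ r := by
          rintro rfl
          exact hne (((parentMap_root f).symm.trans h).symm)
        exact ⟨⟨b, hb⟩, by simp only [← parentMap_of_ne f, h, Sym2.eq_swap]⟩
  have h1 : Nat.card (parentGraph f).edgeSet ≤ Nat.card {x : V // x ≠ r} :=
    (Nat.card_mono (Set.toFinite _) hsub).trans (Finite.card_range_le _)
  have h2 : Nat.card {x : V // x ≠ r} + 1 = Nat.card V := by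
    simp only [Nat.card_eq_fintype_card, Fintype.card_subtype_compl, Fintype.card_subtype_eq]
    have := Fintype.card_pos_iff.2 ⟨r⟩
    omega
  omega

lemma parentGraph_le {G : SimpleGraph V} {f : {x : V // x ≠ r} → V} 
    (h : ∀ v : {x : V // x ≠ r}, G.Adj v (f v)) :
    parentGraph f ≤ G := by
  have aux : ∀ a b, a ≠ b → parentMap f a = b → G.Adj a b := by
    intro a b hne hab
    have ha : a ≠ r := by
      rintro rfl
      exact hne ((parentMap_root f).symm.trans hab)
    rw [← hab, parentMap_of_ne f ⟨a, ha⟩]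
    exact h ⟨a, ha⟩
  intro a b hab
  rw [parentGraph, SimpleGraph.fromRel_adj] at hab
  obtain ⟨hne, hab | hab⟩ := hab
  · exact aux a b hne hab
  · exact (aux b a hne.symm hab).symm

/-- Where `f` and `f'` disagree, the edge to the `f'`-parent must be an `f`-edge traversed
backwards. This persists along the whole `f'`-orbit, which then never meets the root. -/
lemma parentGraph_injOn :
    Set.InjOn (parentGraph (r := r)) {f : {x : V // x ≠ r} → V | ReachesRoot f} := by
  intro f hf f' hf' heq
  by_contra hne
  obtain ⟨v, hv⟩ := Function.ne_iff.1 hne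
  rw [← parentMap_of_ne f, ← parentMap_of_ne f'] at hv
  -- an edge from `x` to its `f'`-parent is the edge from `x` to its `f`-parent, or reversed
  have flip : ∀ x, x ≠ r →
      parentMap f x = parentMap f' x ∨ parentMap f (parentMap f' x) = x := by
    intro x hx
    have hadj : (parentGraph f').Adj x (parentMap f' x) := by
      simp [parentGraph, (hf'.parentMap_ne hx).symm]
    rw [← heq, parentGraph, SimpleGraph.fromRel_adj] at hadj
    exact hadj.2
  have key : ∀ k, (parentMap f')^[k] v ≠ r ∧
      parentMap f (parentMap f' ((parentMap f')^[k] v)) = (parentMap f')^[k] v := by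
    intro k
    induction k with
    | zero => exact ⟨v.2, (flip v v.2).resolve_left hv⟩
    | succ k ih =>
      rw [Function.iterate_succ_apply']
      set x := (parentMap f')^[k] v
      obtain ⟨hx, hfx⟩ := ih
      have hne : parentMap f' x ≠ r := by
        intro h
        rw [h, parentMap_root] at hfx
        exact hx hfx.symm
      refine ⟨hne, (flip _ hne).resolve_left fun h => ?_⟩
      rw [hfx] at h
      exact hf'.parentMap_parentMap_ne hx h.symm
  obtain ⟨k, hk⟩ := hf' v
  exact (key k).1 hk

/-- The parent is the second vertex on the unique path to the root; equality follows because a tree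
is minimal among connected graphs. -/
lemma exists_parentGraph_eq {T : SimpleGraph V} (hT : T.IsTree) :
    ∃ f : {x : V // x ≠ r} → V,
      (∀ v : {x : V // x ≠ r}, T.Adj v (f v)) ∧ ReachesRoot f ∧ parentGraph f = T := by
  choose p hp huniq using fun v : V => hT.existsUnique_path v r
  let f : {x : V // x ≠ r} → V := fun v => (p v).snd
  have hadj : ∀ v : {x : V // x ≠ r}, T.Adj v (f v) := fun v =>
    (p v).adj_snd (SimpleGraph.Walk.not_nil_of_ne v.2)
  have hreach : ∀ (v w : V) (q : T.Walk v w), w = r → q.IsPath →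
      ∃ k, (parentMap f)^[k] v = r := by
    intro v w q
    induction q with
    | nil => exact fun h _ => ⟨0, h⟩
    | @cons a b c hab q ih =>
      rintro rfl hq
      obtain ⟨k, hk⟩ := ih rfl hq.of_cons
      have hac : a ≠ c := by
        rintro rfl
        exact ((SimpleGraph.Walk.cons_isPath_iff _ _).1 hq).2 q.end_mem_support
      refine ⟨k + 1, ?_⟩
      rw [Function.iterate_succ_apply, parentMap_of_ne f ⟨a, hac⟩]
      have : f ⟨a, hac⟩ = b := by
        change (p a).snd = b
        rw [← huniq a _ hq]
        simp
      rw [this, hk]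
  have hf : ReachesRoot f := fun v => hreach v r (p v) rfl (hp v)
  refine ⟨f, hadj, hf, le_antisymm (parentGraph_le hadj) ?_⟩
  exact (SimpleGraph.isTree_iff_minimal_connected.1 hT).2 (parentGraph_connected hf)
    (parentGraph_le hadj)

section Det

variable [Fintype V] [DecidableEq V]

/-- The matrix `1 - F`, where `F` is the matrix of the partial parent function `f`. -/
def parentMatrix (f : {x : V // x ≠ r} → V) : Matrix {x : V // x ≠ r} {x : V // x ≠ r} ℤ :=
  Matrix.of fun v u => (if v = u then 1 else 0) - (if f v = u then 1 else 0)

/-- Ordering vertices by distance to the root makes the matrix unitriangular. -/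
lemma det_parentMatrix_of_reachesRoot {f : {x : V // x ≠ r} → V} (hf : ReachesRoot f) :
    (parentMatrix f).det = 1 := by
  classical
  let height : V → ℕ := fun v => Nat.find (hf v)
  have hlt : ∀ v : {x : V // x ≠ r}, height (f v) < height v := by
    intro v
    have h := Nat.find_spec (hf v)
    change (parentMap f)^[height v] v = r at h
    have hpos : height v ≠ 0 := by
      intro h0
      rw [h0] at h
      exact v.2 h
    obtain ⟨k, hk⟩ := Nat.exists_eq_succ_of_ne_zero hpos
    rw [hk] at h ⊢
    rw [Function.iterate_succ_apply, parentMap_of_ne] at h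
    exact Nat.lt_succ_of_le (Nat.find_min' (hf (f v)) h)
  have htri : BlockTriangular (parentMatrix f)ᵀ (fun v : {x : V // x ≠ r} => height v) := by
    intro i j hij
    have h1 : j ≠ i := by
      rintro rfl
      exact lt_irrefl _ hij
    have h2 : f j ≠ i := by
      intro h
      have := hlt j
      rw [h] at this
      exact lt_asymm hij this
    simp [parentMatrix, h1, h2]
  rw [← det_transpose, htri.det]
  refine prod_eq_one fun k _ => ?_
  have : (parentMatrix f)ᵀ.toSquareBlock (fun v : {x : V // x ≠ r} => height v) k = 1 := by
    ext i j
    have h2 : f j ≠ i := by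
      intro h
      have := hlt j
      rw [h] at this
      have h3 := i.2
      have h4 := j.2
      omega
    by_cases h1 : i = j
    · subst h1
      simp [toSquareBlock_def, parentMatrix, h2]
    · have h3 : (j : {x : V // x ≠ r}) ≠ i := fun h => h1 (Subtype.ext h.symm)
      simp [toSquareBlock_def, parentMatrix, h1, h2, h3]
  rw [this, det_one]

/-- The indicator of the vertices that never reach the root is a nonzero kernel vector. -/
lemma det_parentMatrix_of_not_reachesRoot {f : {x : V // x ≠ r} → V} (hf : ¬ ReachesRoot f) :
    (parentMatrix f).det = 0 := by
  classical
  rw [← Matrix.exists_mulVec_eq_zero_iff]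
  simp only [ReachesRoot, not_forall, not_exists] at hf
  obtain ⟨v₀, hv₀⟩ := hf
  let C : V → Prop := fun v => ∀ k, (parentMap f)^[k] v ≠ r
  have hroot : ¬ C r := fun h => h 0 rfl
  have hC : ∀ v : {x : V // x ≠ r}, C (f v) ↔ C v := by
    intro v
    constructor
    · intro h k
      cases k with
      | zero => exact v.2
      | succ k =>
        rw [Function.iterate_succ_apply, parentMap_of_ne]
        exact h k
    · intro h k
      have := h (k + 1)
      rwa [Function.iterate_succ_apply, parentMap_of_ne] at this
  refine ⟨fun v => if C v then 1 else 0, ?_, ?_⟩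
  · intro h
    have := congrFun h ⟨v₀, hv₀ 0⟩
    have h' : C v₀ := hv₀
    simp [h'] at this
  · ext v
    simp only [mulVec, dotProduct, parentMatrix, of_apply, sub_mul, sum_sub_distrib,
      Pi.zero_apply, ite_mul, one_mul, zero_mul, sum_ite_eq, mem_univ, if_true]
    rw [sub_eq_zero]
    by_cases hr : f v = r
    · have hCv : ¬ C v := by
        rw [← hC v, hr]
        exact hroot
      rw [if_neg hCv]
      symm
      refine sum_eq_zero fun u _ => if_neg ?_
      rw [hr]
      exact u.2.symm
    · rw [sum_eq_single_of_mem (⟨f v, hr⟩ : {x : V // x ≠ r}) (mem_univ _)]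
      · simp [hC v]
      · intro u _ hu
        refine if_neg fun h => hu (Subtype.ext h.symm)

open Classical in
lemma reducedLaplacian_eq_sum (G : SimpleGraph V) (r : V) (v : {x : V // x ≠ r}) :
    reducedLaplacian G r r v = ∑ w ∈ G.neighborFinset v,
      fun u : {x : V // x ≠ r} => ((if v = u then 1 else 0) - (if w = u then 1 else 0) : ℤ) := by
  ext u
  rw [Finset.sum_apply, sum_sub_distrib, sum_const, G.card_neighborFinset_eq_degree]
  simp only [reducedLaplacian, SimpleGraph.lapMatrix, SimpleGraph.degMatrix, submatrix_apply,
    Matrix.sub_apply, diagonal_apply, SimpleGraph.adjMatrix_apply, sum_ite_eq',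
    SimpleGraph.mem_neighborFinset, Subtype.ext_iff]
  congr 1
  split_ifs <;> simp

open Classical in
/-- **Kirchhoff's matrix tree theorem.** -/
theorem det_reducedLaplacian (G : SimpleGraph V) (r : V) :
    (reducedLaplacian G r r).det = spanningTreeCount G := by
  have hdet : (reducedLaplacian G r r).det =
      ∑ f ∈ Fintype.piFinset fun v : {x : V // x ≠ r} => G.neighborFinset v,
        (parentMatrix f).det := by
    -- Each row is a sum over neighbours, so multilinearity expands the determinant over all choices
    -- of a neighbour for each non-root vertex.
    have h := (detRowAlternating (R := ℤ) (n := {x : V // x ≠ r})).toMultilinearMap.map_sum_finset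
      (fun (v : {x : V // x ≠ r}) (w : V) (u : {x : V // x ≠ r}) =>
        ((if v = u then 1 else 0) - (if w = u then 1 else 0) : ℤ))
      (fun v : {x : V // x ≠ r} => G.neighborFinset v)
    have h' : reducedLaplacian G r r = fun v : {x : V // x ≠ r} => ∑ w ∈ G.neighborFinset v,
      fun u : {x : V // x ≠ r} => ((if v = u then 1 else 0) - (if w = u then 1 else 0) : ℤ) :=
      funext fun v => reducedLaplacian_eq_sum G r v
    rw [h']
    exact h
  have hset : {T : SimpleGraph V | T ≤ G ∧ T.IsTree} = parentGraph (r := r) ''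
      ((Fintype.piFinset fun v : {x : V // x ≠ r} => G.neighborFinset v).filter
        ReachesRoot : Finset ({x : V // x ≠ r} → V)) := by
    ext T
    simp only [Set.mem_ofPred_eq, Set.mem_image, SetLike.mem_coe, mem_filter, Fintype.mem_piFinset,
      SimpleGraph.mem_neighborFinset]
    constructor
    · rintro ⟨hle, hT⟩
      obtain ⟨f, hadj, hf, rfl⟩ := exists_parentGraph_eq (r := r) hT
      exact ⟨f, ⟨fun v => hle (hadj v), hf⟩, rfl⟩
    · rintro ⟨f, ⟨hadj, hf⟩, rfl⟩
      exact ⟨parentGraph_le hadj, parentGraph_isTree hf⟩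
  have hinj : Set.InjOn (parentGraph (r := r))
      ((Fintype.piFinset fun v : {x : V // x ≠ r} => G.neighborFinset v).filter
        ReachesRoot : Finset ({x : V // x ≠ r} → V)) :=
    parentGraph_injOn.mono fun f hf => (mem_filter.1 hf).2
  rw [hdet, spanningTreeCount, hset, hinj.ncard_image, Set.ncard_coe_finset,
    card_filter, Nat.cast_sum]
  refine sum_congr rfl fun f _ => ?_
  split_ifs with hf
  · simp [det_parentMatrix_of_reachesRoot hf]
  · simp [det_parentMatrix_of_not_reachesRoot hf]

/-- The number of spanning trees of a connected graph is the order of its critical group. -/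
theorem spanningTreeCount_eq_card_criticalGroup {G : SimpleGraph V} (hG : G.Connected) (r : V) :
    spanningTreeCount G = Nat.card (CriticalGroup G r r) := by
  have hpos : 0 < spanningTreeCount G := by
    obtain ⟨T, hT⟩ := hG.exists_isTree_le
    exact (Set.ncard_pos (Set.toFinite _)).2 ⟨T, hT⟩
  have hdet : (reducedLaplacian G r r).det ≠ 0 := by
    rw [det_reducedLaplacian]
    exact_mod_cast hpos.ne'
  have hinj : Function.Injective (reducedLaplacian G r r).mulVecLin :=
    Matrix.mulVec_injective_of_det_ne_zero hdet
  -- The index of the image of an injective endomorphism of a lattice is the absolute value of its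
  -- determinant.
  have h := Submodule.natAbs_det_equiv (LinearMap.range (reducedLaplacian G r r).mulVecLin)
    (LinearEquiv.ofInjective _ hinj)
  rw [← h]
  have hcomp : (LinearMap.range (reducedLaplacian G r r).mulVecLin).subtype ∘ₗ
      AddMonoidHom.toIntLinearMap
        ((LinearEquiv.ofInjective _ hinj : _ ≃ₗ[ℤ] _) : _ →+ _) =
      Matrix.toLin' (reducedLaplacian G r r) := by
    ext1 x
    rfl
  rw [hcomp, LinearMap.det_toLin', det_reducedLaplacian, Int.natAbs_natCast]

end Det

end MatrixTree

/-! ### The critical group as the universal target of harmonic functions -/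

section Harmonic

variable {V : Type} [Fintype V] [DecidableEq V] {G : SimpleGraph V}
  {A : Type*} [AddCommGroup A]

open Classical in
/-- A function on the vertices of `G` with values in an abelian group is harmonic if its
graph Laplacian vanishes. -/
def IsHarmonic (G : SimpleGraph V) (φ : V → A) : Prop :=
  ∀ v, ∑ w, (if G.Adj v w then φ v - φ w else 0) = 0

open Classical in
lemma sum_lapMatrix_smul (G : SimpleGraph V) (φ : V → A) (v : V) :
    ∑ w, G.lapMatrix ℤ w v • φ w = ∑ w, (if G.Adj v w then φ v - φ w else 0) := by
  have h1 : ∀ w, G.lapMatrix ℤ w v • φ w =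
      (if w = v then (G.degree v : ℤ) • φ v else 0) - (if G.Adj v w then φ w else 0) := by
    intro w
    rw [SimpleGraph.lapMatrix, SimpleGraph.degMatrix, Matrix.sub_apply, sub_smul,
      diagonal_apply, SimpleGraph.adjMatrix_apply]
    congr 1
    · split_ifs with h
      · rw [h]
      · rw [zero_smul]
    · rw [G.adj_comm w v]
      split_ifs <;> simp
  have h2 : ∀ w, (if G.Adj v w then φ v - φ w else 0) =
      (if G.Adj v w then φ v else 0) - (if G.Adj v w then φ w else 0) := by
    intro w
    split_ifs <;> simp
  simp_rw [h1, h2, sum_sub_distrib]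
  congr 1
  rw [sum_ite_eq', if_pos (mem_univ v), ← sum_filter, sum_const,
    ← G.card_neighborFinset_eq_degree, G.neighborFinset_eq_filter, natCast_zsmul]

open Classical in
lemma isHarmonic_iff {φ : V → A} :
    IsHarmonic G φ ↔ ∀ v, ∑ w, G.lapMatrix ℤ w v • φ w = 0 := by
  simp_rw [sum_lapMatrix_smul]
  rfl

open Classical in
lemma IsHarmonic.linearCombination_mulVec {φ : V → A} (hφ : IsHarmonic G φ) (c : V → ℤ) :
    Fintype.linearCombination ℤ φ (G.lapMatrix ℤ *ᵥ c) = 0 := by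
  rw [isHarmonic_iff] at hφ
  simp only [Fintype.linearCombination_apply, mulVec, dotProduct, sum_smul]
  rw [sum_comm]
  refine sum_eq_zero fun v _ => ?_
  simp_rw [mul_comm _ (c v), mul_smul]
  rw [← smul_sum, hφ, smul_zero]

open Classical in
lemma sum_lapMatrix_mulVec (G : SimpleGraph V) (c : V → ℤ) :
    ∑ w, (G.lapMatrix ℤ *ᵥ c) w = 0 := by
  have h : IsHarmonic G fun _ : V => (1 : ℤ) := fun v => sum_eq_zero fun w _ => by simp
  simpa [Fintype.linearCombination_apply] using h.linearCombination_mulVec c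

open Classical in
lemma mem_range_reducedLaplacian_iff {u v : V} {z : {x : V // x ≠ u} → ℤ} :
    z ∈ LinearMap.range (reducedLaplacian G u v).mulVecLin ↔
      ∃ c : V → ℤ, ∀ w : {x : V // x ≠ u}, z w = (G.lapMatrix ℤ *ᵥ c) w := by
  constructor
  · rintro ⟨c, rfl⟩
    refine ⟨fun x => if h : x ≠ v then c ⟨x, h⟩ else 0, fun w => ?_⟩
    simp only [mulVecLin_apply, mulVec, dotProduct]
    rw [Fintype.sum_eq_add_sum_subtype_ne _ v]
    simp only [ne_eq, not_true_eq_false, dite_false, mul_zero, zero_add]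
    refine sum_congr rfl fun x _ => ?_
    rw [dif_pos x.2]
    rfl
  · rintro ⟨c, hc⟩
    -- Constants lie in the kernel of the Laplacian, so the deleted coordinate may be normalized to
    -- zero.
    refine ⟨fun x => c x - c v, ?_⟩
    ext w
    have hconst : (G.lapMatrix ℤ *ᵥ fun _ => c v) = 0 := by
      have : (fun _ : V => c v) = c v • fun _ : V => (1 : ℤ) := by
        ext
        simp
      rw [this, mulVec_smul, SimpleGraph.lapMatrix_mulVec_const_eq_zero, smul_zero]
    have h : (G.lapMatrix ℤ *ᵥ c) w = (G.lapMatrix ℤ *ᵥ fun x => c x - c v) w := by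
      have : (fun x => c x - c v) = c - fun _ => c v := rfl
      rw [this, mulVec_sub, hconst, sub_zero]
    rw [hc w, h]
    simp only [mulVecLin_apply, mulVec, dotProduct]
    rw [Fintype.sum_eq_add_sum_subtype_ne (fun x => G.lapMatrix ℤ w x * (c x - c v)) v,
      sub_self, mul_zero, zero_add]
    rfl

/-- If `φ : V → A` is universal among the harmonic functions vanishing at `r` with values in abelian
groups, then `A` is the critical group. -/
theorem nonempty_criticalGroup_addEquiv {r : V} {φ : V → A} (hr : φ r = 0)
    (hφ : IsHarmonic G φ) (hgen : AddSubgroup.closure (Set.range φ) = ⊤)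
    (huniv : ∀ (B : Type) [AddCommGroup B] (f : V → B), f r = 0 → IsHarmonic G f →
      ∃ ψ : A →+ B, ∀ v, ψ (φ v) = f v) (u v : V) :
    Nonempty (CriticalGroup G u v ≃+ A) := by
  classical
  -- The quotient by `R` carries the tautological harmonic function vanishing at `r`; universality
  -- of `φ` applied to it shows that `φ` imposes no relations beyond `R`.
  let R : Submodule ℤ (V → ℤ) :=
    LinearMap.range (G.lapMatrix ℤ).mulVecLin ⊔ Submodule.span ℤ {Pi.single r 1}
  have hker : ∀ z : V → ℤ, Fintype.linearCombination ℤ φ z = 0 → z ∈ R := by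
    intro z hz
    let f : V → (V → ℤ) ⧸ R := fun w => R.mkQ (Pi.single w 1)
    have hmk : ∀ z : V → ℤ, R.mkQ z = ∑ w, z w • f w := by
      intro z
      have hz : z = ∑ w, z w • (Pi.single w 1 : V → ℤ) := by
        ext x
        simp [Finset.sum_apply, Pi.single_apply]
      conv_lhs => rw [hz]
      rw [map_sum]
      exact sum_congr rfl fun w _ => map_smul _ _ _
    have hfr : f r = 0 := (Submodule.Quotient.mk_eq_zero R).2
      (Submodule.mem_sup_right (Submodule.mem_span_singleton_self _))
    have hf : IsHarmonic G f := by
      rw [isHarmonic_iff]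
      intro x
      have h : R.mkQ (G.lapMatrix ℤ *ᵥ Pi.single x 1) = 0 :=
        (Submodule.Quotient.mk_eq_zero R).2 (Submodule.mem_sup_left ⟨_, rfl⟩)
      rw [hmk] at h
      simpa using h
    obtain ⟨ψ, hψ⟩ := huniv _ f hfr hf
    have h := congrArg ψ hz
    rw [Fintype.linearCombination_apply, map_sum, map_zero] at h
    simp_rw [map_zsmul, hψ] at h
    rw [← hmk] at h
    exact (Submodule.Quotient.mk_eq_zero R).1 h
  -- Subtracting `φ u` lets the deleted row `u` differ from the root: a vector off `u` extends
  -- uniquely to one of total sum zero.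
  let Θ : ({x : V // x ≠ u} → ℤ) →ₗ[ℤ] A :=
    Fintype.linearCombination ℤ fun w : {x : V // x ≠ u} => φ w - φ u
  have hΘ : ∀ c : V → ℤ, Θ (fun w => c w) =
      Fintype.linearCombination ℤ φ c - (∑ w, c w) • φ u := by
    intro c
    have h : ∑ w, c w • (φ w - φ u) = Fintype.linearCombination ℤ φ c - (∑ w, c w) • φ u := by
      simp_rw [smul_sub, sum_sub_distrib, sum_smul, Fintype.linearCombination_apply]
    rw [← h, Fintype.sum_eq_add_sum_subtype_ne _ u, sub_self, smul_zero, zero_add]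
    rfl
  have hΘker : LinearMap.range (reducedLaplacian G u v).mulVecLin = LinearMap.ker Θ := by
    ext z
    rw [mem_range_reducedLaplacian_iff, LinearMap.mem_ker]
    constructor
    · rintro ⟨c, hc⟩
      have : z = fun w : {x : V // x ≠ u} => (G.lapMatrix ℤ *ᵥ c) w := funext hc
      rw [this, hΘ, hφ.linearCombination_mulVec, sum_lapMatrix_mulVec, zero_smul, sub_zero]
    · intro hz
      let y : V → ℤ := fun w => if h : w ≠ u then z ⟨w, h⟩ else -∑ x, z x
      have hyz : ∀ w : {x : V // x ≠ u}, z w = y w := fun w => by simp [y, w.2]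
      have hy : ∑ w, y w = 0 := by
        rw [Fintype.sum_eq_add_sum_subtype_ne _ u]
        simp_rw [← hyz]
        simp [y]
      have hmem := hker y (by
        have h := hΘ y
        rw [hy, zero_smul, sub_zero] at h
        rw [← h, ← hz]
        exact congrArg Θ (funext hyz).symm)
      obtain ⟨_, ⟨c, rfl⟩, _, hk, hsum⟩ := Submodule.mem_sup.1 hmem
      obtain ⟨k, rfl⟩ := Submodule.mem_span_singleton.1 hk
      -- Laplacian images and `y` both have coordinate sum zero, so the root generator cannot
      -- contribute.
      have hk0 : k = 0 := by
        have h := congrArg (fun y : V → ℤ => ∑ w, y w) hsum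
        simp only [Pi.add_apply, sum_add_distrib, mulVecLin_apply, sum_lapMatrix_mulVec,
          zero_add, hy] at h
        simpa [Pi.single_apply] using h
      refine ⟨c, fun w => ?_⟩
      rw [hyz, ← hsum, hk0]
      simp
  have hsurj : Function.Surjective Θ := by
    have hmem : ∀ w, φ w - φ u ∈ Θ.toAddMonoidHom.range := by
      intro w
      by_cases h : w = u
      · rw [h, sub_self]
        exact zero_mem _
      · refine ⟨Pi.single ⟨w, h⟩ 1, ?_⟩
        simp [Θ]
    have htop : Θ.toAddMonoidHom.range = ⊤ := by
      rw [eq_top_iff, ← hgen, AddSubgroup.closure_le]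
      rintro _ ⟨w, rfl⟩
      have := sub_mem (hmem w) (hmem r)
      rwa [hr, zero_sub, sub_neg_eq_add, sub_add_cancel] at this
    exact AddMonoidHom.range_eq_top.1 htop
  exact ⟨((Submodule.quotEquivOfEq _ _ hΘker).trans
    (Θ.quotKerEquivOfSurjective hsurj)).toAddEquiv⟩

end Harmonic

/-! ### The integer sequences and their closed forms -/

section Sequences

/-- The integer sequence `a_n`, by its recurrence. -/
def seqA (m : ℕ) : ℕ → ℤ
  | 0 => 0
  | 1 => 1
  | k + 2 => (m + 2) * seqA m (k + 1) - seqA m k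

/-- The partial sums of `a_0, a_1, …`. -/
def seqS (m k : ℕ) : ℤ := ∑ i ∈ range (k + 1), seqA m i

/-- The differences `a_{k+1} - a_k`. -/
def seqP (m k : ℕ) : ℤ := seqA m (k + 1) - seqA m k

/-- The partial sums of the sums `seqS`. -/
def seqT (m n : ℕ) : ℤ := ∑ k ∈ range n, seqS m k

@[simp] lemma seqA_zero (m : ℕ) : seqA m 0 = 0 := rfl
@[simp] lemma seqA_one (m : ℕ) : seqA m 1 = 1 := rfl
lemma seqA_add_two (m k : ℕ) : seqA m (k + 2) = (m + 2) * seqA m (k + 1) - seqA m k := rfl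

lemma seqS_succ (m k : ℕ) : seqS m (k + 1) = seqS m k + seqA m (k + 1) := sum_range_succ _ _
@[simp] lemma seqS_zero (m : ℕ) : seqS m 0 = 0 := by simp [seqS]

@[simp] lemma seqP_zero (m : ℕ) : seqP m 0 = 1 := by simp [seqP]

lemma seqP_succ (m k : ℕ) : seqP m (k + 1) = seqP m k + m * seqA m (k + 1) := by
  rw [seqP, seqP, seqA_add_two]
  ring

lemma seqP_eq (m k : ℕ) : seqP m k = 1 + m * seqS m k := by
  induction k with
  | zero => simp
  | succ k ih =>
    rw [seqP_succ, ih, seqS_succ]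
    ring

lemma sum_seqP (m n : ℕ) : ∑ k ∈ range n, seqP m k = seqA m n := by
  simp only [seqP, sum_range_sub, seqA_zero, sub_zero]

lemma seqA_eq (m n : ℕ) : seqA m n = n + m * seqT m n := by
  rw [← sum_seqP]
  simp [seqP_eq, sum_add_distrib, seqT, mul_sum]

lemma seqP_pos_and_seqA_nonneg (m k : ℕ) : 0 < seqP m k ∧ 0 ≤ seqA m k := by
  induction k with
  | zero => simp
  | succ k ih =>
    have h : 0 ≤ seqA m (k + 1) := by
      have : seqA m (k + 1) = seqA m k + seqP m k := by
        rw [seqP]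
        ring
      linarith
    refine ⟨?_, h⟩
    rw [seqP_succ]
    have : 0 ≤ (m : ℤ) * seqA m (k + 1) := by positivity
    linarith

lemma seqP_mono (m : ℕ) : Monotone (seqP m) := by
  refine monotone_nat_of_le_succ fun k => ?_
  rw [seqP_succ]
  have : 0 ≤ (m : ℤ) * seqA m (k + 1) := mul_nonneg (by positivity) (seqP_pos_and_seqA_nonneg m _).2
  linarith

/-- The integer sequence `b_n`. -/
def seqB (m n : ℕ) : ℤ := (m + n) * seqS m (n - 1) + 1 - n - (m + 1) * seqT m n

lemma seqB_mul (m k : ℕ) :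
    m * seqB m (k + 1) = (m + (k + 1 : ℕ)) * seqP m k - (m + 1) * seqA m (k + 1) := by
  rw [seqB, seqA_eq, seqP_eq, Nat.add_sub_cancel]
  push_cast
  ring

/-- The bound rests on `a_{k+1} = p_0 + ⋯ + p_k ≤ (k+1) p_k`, where `p` is increasing. By `seqB_mul`
it is the nonnegativity of `b_{k+1}`. -/
lemma succ_mul_seqA_le (m k : ℕ) :
    (m + 1) * seqA m (k + 1) ≤ (m + (k + 1 : ℕ)) * seqP m k := by
  induction k with
  | zero => simp
  | succ k ih =>
    have h1 : seqA m (k + 2) = seqA m (k + 1) + seqP m (k + 1) := by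
      rw [seqP]
      ring
    have h2 := seqP_succ m k
    have h3 : seqA m (k + 1) ≤ (k + 1) * seqP m k := by
      rw [← sum_seqP]
      calc ∑ i ∈ range (k + 1), seqP m i ≤ ∑ _i ∈ range (k + 1), seqP m k :=
            sum_le_sum fun i hi => seqP_mono m (Nat.lt_succ_iff.1 (mem_range.1 hi))
        _ = (k + 1) * seqP m k := by simp
    have h4 : 0 ≤ (k : ℤ) * (m * seqA m (k + 1)) :=
      mul_nonneg (by positivity) (mul_nonneg (by positivity) (seqP_pos_and_seqA_nonneg m _).2)
    rw [h1]
    push_cast at ih ⊢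
    nlinarith [(seqP_pos_and_seqA_nonneg m k).1]

lemma seqB_nonneg {m n : ℕ} (hm : 0 < m) (hn : 0 < n) : 0 ≤ seqB m n := by
  obtain ⟨k, rfl⟩ := Nat.exists_eq_succ_of_ne_zero hn.ne'
  have h := seqB_mul m k
  have h' := succ_mul_seqA_le m k
  have hm' : (0 : ℤ) < m := by exact_mod_cast hm
  rw [← mul_nonneg_iff_of_pos_left hm', Nat.succ_eq_add_one, h]
  linarith

lemma disc_sq (m : ℕ) : disc m ^ 2 = (m : ℝ) ^ 2 + 4 * m := Real.sq_sqrt (by positivity)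

lemma disc_pos {m : ℕ} (hm : 0 < m) : 0 < disc m := by
  have : (0 : ℝ) < m := by exact_mod_cast hm
  exact Real.sqrt_pos.2 (by positivity)

/-- Both bases are roots of `X² - (m+2)X + 1`, the characteristic polynomial of the recurrence. -/
lemma disc_mul_seqA (m n : ℕ) :
    disc m * seqA m n = ((m + 2 + disc m) / 2) ^ n - ((m + 2 - disc m) / 2) ^ n := by
  have hD := disc_sq m
  induction n using Nat.twoStepInduction with
  | zero => simp
  | one =>
    simp
    ring
  | more k h1 h2 =>
    rw [seqA_add_two]
    push_cast
    have h : disc m * ((m + 2) * seqA m (k + 1) - seqA m k) =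
        (m + 2) * (disc m * seqA m (k + 1)) - disc m * seqA m k := by ring
    rw [h, h1, h2]
    set r := ((m + 2 + disc m) / 2 : ℝ) with hr
    set s := ((m + 2 - disc m) / 2 : ℝ) with hs
    have hr2 : r ^ 2 = (m + 2) * r - 1 := by
      rw [hr]
      linear_combination hD / 4
    have hs2 : s ^ 2 = (m + 2) * s - 1 := by
      rw [hs]
      linear_combination hD / 4
    rw [pow_add r k 2, pow_add s k 2, hr2, hs2]
    ring

lemma seqA_eq_paramA {m : ℕ} (hm : 0 < m) (n : ℕ) : (seqA m n : ℝ) = paramA m n := by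
  rw [paramA, ← disc_mul_seqA, ← mul_assoc, one_div_mul_cancel (disc_pos hm).ne', one_mul]

/-- The identity behind the coefficients of the closed form of `b_n`; it is applied to both square
roots of `m² + 4m`. -/
lemma coeff_identity {m n D : ℝ} (hD : D ^ 2 = m ^ 2 + 4 * m) :
    D * m * ((m ^ 2 - m - m * D - D + 2 * m * n) * (m + 4 - D)) * ((m + 2 + D) / 2) =
      4 * m ^ 2 * (m + 4) * ((m + n) * ((m + 2 + D) / 2 - 1) - (m + 1) * ((m + 2 + D) / 2)) := by
  linear_combination (m * ((2 * m * (m + 4) * (m + n) - 2 * (m * (m + n) + 2 * m + 2) * D) -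
    2 * (m * (m + n) + 2 * m + 2) * (m + 2)) / 2 + m * D * ((m + 2 + D) / 2) * (m + 1)) * hD

lemma disc_mul_coeffE {m : ℕ} (hm : 0 < m) (n : ℕ) :
    disc m * m * coeffE m n * ((m + 2 + disc m) / 2) =
      (m + n) * ((m + 2 + disc m) / 2 - 1) - (m + 1) * ((m + 2 + disc m) / 2) := by
  have hm' : (0 : ℝ) < m := by exact_mod_cast hm
  have h := coeff_identity (n := n) (disc_sq m)
  have hne : 4 * (m : ℝ) ^ 2 * (m + 4) ≠ 0 := by positivity
  rw [coeffE]
  refine mul_left_cancel₀ hne ?_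
  rw [← h]
  field_simp

lemma disc_mul_coeffF {m : ℕ} (hm : 0 < m) (n : ℕ) :
    disc m * m * coeffF m n * ((m + 2 - disc m) / 2) =
      (m + n) * ((m + 2 - disc m) / 2 - 1) - (m + 1) * ((m + 2 - disc m) / 2) := by
  have hm' : (0 : ℝ) < m := by exact_mod_cast hm
  -- The coefficient `f` is minus `e` with the square root negated.
  have h := coeff_identity (n := n) (D := -disc m) ((neg_sq _).trans (disc_sq m))
  have hne : 4 * (m : ℝ) ^ 2 * (m + 4) ≠ 0 := by positivity
  rw [coeffF]
  refine mul_left_cancel₀ hne ?_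
  simp only [← sub_eq_add_neg] at h
  rw [← h]
  field_simp
  ring

lemma seqB_eq_paramB {m n : ℕ} (hm : 0 < m) (hn : 0 < n) : (seqB m n : ℝ) = paramB m n := by
  obtain ⟨k, rfl⟩ := Nat.exists_eq_succ_of_ne_zero hn.ne'
  rw [Nat.succ_eq_add_one]
  have hm' : (0 : ℝ) < m := by exact_mod_cast hm
  have hb : (m : ℝ) * seqB m (k + 1) =
      (m + (k + 1 : ℕ)) * (seqA m (k + 1) - seqA m k) - (m + 1) * seqA m (k + 1) := by
    have := seqB_mul m k
    rw [seqP] at this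
    exact_mod_cast this
  have h1 := disc_mul_seqA m (k + 1)
  have h0 := disc_mul_seqA m k
  have hE := disc_mul_coeffE hm (k + 1)
  have hF := disc_mul_coeffF hm (k + 1)
  rw [pow_succ, pow_succ] at h1
  rw [paramB, pow_succ, pow_succ]
  generalize ((m + 2 + disc m) / 2 : ℝ) = r at *
  generalize ((m + 2 - disc m) / 2 : ℝ) = s at *
  refine mul_left_cancel₀ (mul_ne_zero (disc_pos hm).ne' hm'.ne') ?_
  linear_combination disc m * hb + ((m + (k + 1 : ℕ)) - (m + 1)) * h1 - (m + (k + 1 : ℕ)) * h0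
    - r ^ k * hE + s ^ k * hF

end Sequences

/-! ### Harmonic functions on the join -/

section JoinPath

variable {m n : ℕ} {B : Type*} [AddCommGroup B]

lemma completeJoinPath_adj_inl_inl (i i' : Fin m) :
    (completeJoinPath m n).Adj (Sum.inl i) (Sum.inl i') ↔ i ≠ i' := by
  simp [completeJoinPath, graphJoin]

lemma completeJoinPath_adj_inl_inr (i : Fin m) (j : Fin n) :
    (completeJoinPath m n).Adj (Sum.inl i) (Sum.inr j) := by
  simp [completeJoinPath, graphJoin]

lemma completeJoinPath_adj_inr_inl (i : Fin m) (j : Fin n) :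
    (completeJoinPath m n).Adj (Sum.inr j) (Sum.inl i) := by
  simp [completeJoinPath, graphJoin]

lemma completeJoinPath_adj_inr_inr (j j' : Fin n) :
    (completeJoinPath m n).Adj (Sum.inr j) (Sum.inr j') ↔
      (j : ℕ) + 1 = j' ∨ (j' : ℕ) + 1 = j := by
  simp [completeJoinPath, graphJoin, SimpleGraph.pathGraph_adj]

lemma completeJoinPath_connected (hm : 0 < m) (hn : 0 < n) :
    (completeJoinPath m n).Connected := by
  have h : ∀ v, (completeJoinPath m n).Reachable (Sum.inl ⟨0, hm⟩) v := by
    have hj : ∀ j, (completeJoinPath m n).Reachable (Sum.inl ⟨0, hm⟩) (Sum.inr j) := fun j =>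
      (completeJoinPath_adj_inl_inr _ j).reachable
    rintro (i | j)
    · exact (hj ⟨0, hn⟩).trans (completeJoinPath_adj_inr_inl i _).reachable
    · exact hj j
  exact { preconnected := fun u v => (h u).symm.trans (h v), nonempty := ⟨Sum.inl ⟨0, hm⟩⟩ }

open Classical in
lemma sum_pathNeighbors (Y : ℕ → B) (j : Fin n) :
    ∑ j' : Fin n, (if (j : ℕ) + 1 = j' ∨ (j' : ℕ) + 1 = j then Y j - Y j' else 0) =
      (if (j : ℕ) + 1 < n then Y j - Y (j + 1) else 0) +
        (if 0 < (j : ℕ) then Y j - Y (j - 1) else 0) := by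
  rw [Fin.sum_univ_eq_sum_range
    fun k => if (j : ℕ) + 1 = k ∨ k + 1 = j then Y j - Y k else 0]
  -- At `j = 0` truncated subtraction makes `j - 1` equal to `j`; the inner guard keeps that end of
  -- the path from having a left neighbour.
  have h : ∀ k, (if (j : ℕ) + 1 = k ∨ k + 1 = j then Y j - Y k else 0) =
      (if k = (j : ℕ) + 1 then Y j - Y k else 0) +
        (if k = (j : ℕ) - 1 then (if 0 < (j : ℕ) then Y j - Y k else 0) else 0) := by
    intro k
    split_ifs <;> first | omega | simp
  simp_rw [h, sum_add_distrib, sum_ite_eq', mem_range]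
  congr 1
  rw [if_pos (by omega)]

/-- Harmonicity on `K_m ∨ P_n`, spelled out. -/
lemma isHarmonic_completeJoinPath_iff {f : Fin m ⊕ Fin n → B} {Y : ℕ → B}
    (hY : ∀ j : Fin n, f (Sum.inr j) = Y j) :
    IsHarmonic (completeJoinPath m n) f ↔
      (∀ i, (m + n) • f (Sum.inl i) = ∑ i, f (Sum.inl i) + ∑ k ∈ range n, Y k) ∧
      ∀ k < n, m • Y k - ∑ i, f (Sum.inl i) +
        ((if k + 1 < n then Y k - Y (k + 1) else 0) +
          (if 0 < k then Y k - Y (k - 1) else 0)) = 0 := by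
  have hl : ∀ i, (∑ i', if i ≠ i' then f (Sum.inl i) - f (Sum.inl i') else 0) =
      m • f (Sum.inl i) - ∑ i', f (Sum.inl i') := by
    intro i
    have : ∀ i', (if i ≠ i' then f (Sum.inl i) - f (Sum.inl i') else 0) =
        f (Sum.inl i) - f (Sum.inl i') := by
      intro i'
      split_ifs with h
      · rfl
      · rw [not_not.1 h, sub_self]
    simp_rw [this]
    simp
  simp only [IsHarmonic, Sum.forall, Fintype.sum_sum_type, completeJoinPath_adj_inl_inl,
    completeJoinPath_adj_inl_inr, completeJoinPath_adj_inr_inl, completeJoinPath_adj_inr_inr,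
    if_true, hY, sum_pathNeighbors, sum_sub_distrib, sum_const, card_univ, Fintype.card_fin]
  refine and_congr (forall_congr' fun i => ?_) Fin.forall_iff
  rw [Fin.sum_univ_eq_sum_range]
  rw [show (∑ i', if i ≠ i' then f (Sum.inl i) - f (Sum.inl i') else 0) = _ from hl i]
  rw [add_smul, ← sub_eq_zero (b := _ + _)]
  refine Eq.congr ?_ rfl
  abel

lemma isHarmonic_elim {x : Fin m → B} {y d : B} (hx : ∑ i, x i = m • y - d)
    (hN : ∀ i, (m + n) • x i = 0) (hy : (m + n) • y = (1 - seqT m n) • d) :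
    IsHarmonic (completeJoinPath m n)
      (Sum.elim x fun j : Fin n => y + seqS m j • d) := by
  -- Multiplying `hy` by `m` and using `(m+n)(m y - d) = 0` gives `(m+n) d = m(1 - T) d`, and `a_n =
  -- n + mT`. This is the equation needed at the far end of the path.
  have hd : seqA m n • d = 0 := by
    have h : (m + n) • (m • y - d) = 0 := by
      rw [← hx, smul_sum]
      exact sum_eq_zero fun i _ => hN i
    rw [smul_sub, smul_comm, hy, ← natCast_zsmul d, ← natCast_zsmul _ m, smul_smul,
      ← sub_smul] at h
    rw [seqA_eq, ← neg_eq_zero, ← neg_smul, ← h]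
    congr 1
    push_cast
    ring
  rw [isHarmonic_completeJoinPath_iff (Y := fun k => y + seqS m k • d) fun j => rfl]
  simp only [Sum.elim_inl]
  constructor
  · intro i
    rw [hN, hx, sum_add_distrib, ← sum_smul, sum_const, card_range, ← seqT]
    have : (m + n) • y = d - seqT m n • d := by rw [hy, sub_smul, one_smul]
    rw [add_smul] at this
    symm
    rw [← sub_eq_zero] at this
    rw [← this]
    abel
  · intro k hk
    have h1 : (if 0 < k then (y + seqS m k • d) - (y + seqS m (k - 1) • d) else 0) =
        seqA m k • d := by
      cases k with
      | zero => simp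
      | succ k =>
        rw [if_pos k.succ_pos, Nat.add_sub_cancel, seqS_succ, add_smul]
        abel
    have h2 : (if k + 1 < n then (y + seqS m k • d) - (y + seqS m (k + 1) • d) else 0) =
        -(seqA m (k + 1) • d) := by
      split_ifs with h
      · rw [seqS_succ, add_smul]
        abel
      · obtain rfl : n = k + 1 := by omega
        rw [hd, neg_zero]
    have h3 : m • (y + seqS m k • d) - (m • y - d) = seqP m k • d := by
      rw [seqP_eq, add_smul, one_smul, mul_smul, natCast_zsmul, smul_add]
      abel
    rw [h1, h2, hx, h3, seqP, sub_smul]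
    abel

/-- A harmonic function on `K_m ∨ P_n` vanishing at a vertex of `K_m` is determined by its values
on `K_m` and at one end of the path. -/
lemma IsHarmonic.completeJoinPath_relations (hn : 0 < n) {f : Fin m ⊕ Fin n → B} {i₀ : Fin m}
    (h₀ : f (Sum.inl i₀) = 0) (hf : IsHarmonic (completeJoinPath m n) f) {y d : B}
    (hy : y = f (Sum.inr ⟨0, hn⟩)) (hd : d = m • y - ∑ i, f (Sum.inl i)) :
    (∀ i, (m + n) • f (Sum.inl i) = 0) ∧
      (∀ j : Fin n, f (Sum.inr j) = y + seqS m j • d) ∧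
      (m + n) • y = (1 - seqT m n) • d := by
  obtain ⟨Y, hY⟩ : ∃ Y : ℕ → B, ∀ j : Fin n, f (Sum.inr j) = Y j :=
    ⟨fun k => if h : k < n then f (Sum.inr ⟨k, h⟩) else 0, fun j => by simp⟩
  obtain ⟨h1, h2⟩ := (isHarmonic_completeJoinPath_iff hY).1 hf
  -- At the root the left side is zero, so the sum of all values vanishes.
  have hS := h1 i₀
  rw [h₀, smul_zero] at hS
  have hN : ∀ i, (m + n) • f (Sum.inl i) = 0 := fun i => by rw [h1, ← hS]
  have hX : ∑ i, f (Sum.inl i) = m • y - d := by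
    rw [hd]
    abel
  have key : ∀ k, k + 1 < n → Y k = y + seqS m k • d ∧ Y (k + 1) = y + seqS m (k + 1) • d := by
    intro k
    induction k with
    | zero =>
      intro hk
      have hY0 : Y 0 = y := by rw [hy, hY]
      have h := h2 0 hn
      rw [if_pos hk, if_neg (lt_irrefl 0), hX, hY0, zero_add] at h
      refine ⟨by simp [hY0], ?_⟩
      rw [seqS_succ, seqS_zero, zero_add, zero_add, seqA_one, one_smul, ← sub_eq_zero,
        ← neg_eq_zero, ← h]
      abel
    | succ k ih =>
      intro hk
      obtain ⟨ih1, ih2⟩ := ih (by omega)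
      refine ⟨ih2, ?_⟩
      have h := h2 (k + 1) (by omega)
      rw [if_pos hk, if_pos k.succ_pos, Nat.add_sub_cancel, hX, ih1, ih2] at h
      have h3 : m • (y + seqS m (k + 1) • d) - (m • y - d) = seqP m (k + 1) • d := by
        rw [seqP_eq, add_smul, one_smul, mul_smul, natCast_zsmul, smul_add]
        abel
      rw [h3, seqP, sub_smul] at h
      rw [seqS_succ m (k + 1), add_smul, ← sub_eq_zero, ← neg_eq_zero, ← h,
        seqS_succ m k, add_smul]
      abel
  have hYall : ∀ k < n, Y k = y + seqS m k • d := by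
    intro k hk
    cases k with
    | zero =>
      rw [seqS_zero, zero_smul, add_zero, hy, hY]
    | succ k => exact (key k hk).2
  refine ⟨hN, fun j => by rw [hY, hYall j j.2], ?_⟩
  rw [sum_congr rfl fun k hk => hYall k (mem_range.1 hk), sum_add_distrib, ← sum_smul, sum_const,
    card_range, ← seqT, hX] at hS
  rw [sub_smul, one_smul, add_smul, ← sub_eq_zero, hS]
  abel

end JoinPath

/-! ### Diagonalizing the relations -/

section Presentation

variable {B : Type*} [AddCommGroup B]

/-- The homomorphism from `ℤ/n` that sends `1` to an element killed by `n`. -/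
def zmodHom (n : ℕ) (w : B) (h : n • w = 0) : ZMod n →+ B :=
  ZMod.lift n ⟨zmultiplesHom B w, by simpa using h⟩

@[simp] lemma zmodHom_intCast (n : ℕ) (w : B) (h : n • w = 0) (i : ℤ) :
    zmodHom n w h i = i • w := by
  simp [zmodHom]

@[simp] lemma zmodHom_one (n : ℕ) (w : B) (h : n • w = 0) : zmodHom n w h 1 = w := by
  simpa using zmodHom_intCast n w h 1

/-- The critical group of the fan `K_1 ∨ P_n`. -/
theorem nonempty_criticalGroup_fan_addEquiv {n a : ℕ} (hn : 0 < n) (ha : (a : ℤ) = seqA 1 n)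
    (u v : Fin 1 ⊕ Fin n) :
    Nonempty (CriticalGroup (completeJoinPath 1 n) u v ≃+ ZMod a) := by
  have haT : (a : ℤ) = n + seqT 1 n := by
    rw [ha, seqA_eq]
    simp
  have hrel : (1 + n) • (1 : ZMod a) = (1 - seqT 1 n) • (1 : ZMod a) := by
    have h : ((n + seqT 1 n : ℤ) : ZMod a) = 0 := by
      rw [← haT]
      simp
    push_cast at h
    rw [← sub_eq_zero]
    simp only [nsmul_eq_mul, zsmul_eq_mul, mul_one]
    push_cast
    linear_combination h
  -- With `m = 1` the only `x` is the root value, so `d = y` and the single relation reads `a y =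
  -- 0`.
  refine nonempty_criticalGroup_addEquiv (r := Sum.inl 0)
    (φ := Sum.elim (fun _ => 0) fun j : Fin n => (1 : ZMod a) + seqS 1 j • (1 : ZMod a))
    rfl (isHarmonic_elim (by simp) (by simp) hrel) ?_ ?_ u v
  · rw [eq_top_iff]
    rintro p -
    obtain ⟨i, rfl⟩ := ZMod.intCast_surjective p
    have h : (1 : ZMod a) ∈ AddSubgroup.closure (Set.range
        (Sum.elim (fun _ : Fin 1 => 0) fun j : Fin n => (1 : ZMod a) + seqS 1 j • (1 : ZMod a))) :=
      AddSubgroup.subset_closure ⟨Sum.inr ⟨0, hn⟩, by simp⟩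
    simpa using zsmul_mem h i
  · intro B _ f h₀ hf
    obtain ⟨-, h2, h3⟩ := hf.completeJoinPath_relations hn h₀ (y := f (Sum.inr ⟨0, hn⟩))
      (d := f (Sum.inr ⟨0, hn⟩)) rfl (by simp [h₀])
    refine ⟨zmodHom a (f (Sum.inr ⟨0, hn⟩)) ?_, ?_⟩
    · rw [← natCast_zsmul] at h3 ⊢
      rw [← sub_eq_zero, ← sub_smul] at h3
      rw [haT, ← h3]
      congr 1
      push_cast
      ring
    · rintro (i | j)
      · rw [Subsingleton.elim i 0, h₀]
        simp
      · rw [h2 j, Sum.elim_inr, map_add, map_zsmul, zmodHom_one]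

/-- The critical group of `K_m ∨ P_n` for `m ≥ 2`, with the diagonalization of its relation matrix
given by a Bézout identity. -/
theorem nonempty_criticalGroup_completeJoinPath_addEquiv {k n g N' a : ℕ} {b' ρ τ : ℤ}
    (hn : 0 < n) (hN : k + 2 + n = g * N') (hT : 1 - seqT (k + 2) n = g * b')
    (ha : (a : ℤ) = seqA (k + 2) n) (hbez : ρ * b' + τ * N' = 1) (u v : Fin (k + 2) ⊕ Fin n) :
    Nonempty (CriticalGroup (completeJoinPath (k + 2) n) u v ≃+
      ZMod g × (Fin k → ZMod (k + 2 + n)) × ZMod (N' * a)) := by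
  have haT : (a : ℤ) = g * (N' - (k + 2) * b') := by
    have hN' : (k : ℤ) + 2 + n = g * N' := by exact_mod_cast hN
    have := seqA_eq (k + 2) n
    push_cast at this
    linear_combination ha + this + (k + 2 : ℤ) * -hT + hN'
  have hMz : ((N' : ZMod (N' * a)) * g * (N' - (k + 2) * b')) = 0 := by
    have h : ((N' * a : ℤ) : ZMod (N' * a)) = 0 := by
      have := ZMod.natCast_self (N' * a)
      exact_mod_cast this
    rw [haT] at h
    push_cast at h
    linear_combination h
  let e : Fin k → ZMod g × (Fin k → ZMod (k + 2 + n)) × ZMod (N' * a) :=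
    fun i => (0, Pi.single i 1, 0)
  -- The diagonal generators are `w = N' y - b' d` and `v = ρ y + τ d`, a unimodular change by
  -- Bézout. Its inverse, `y = τ w + b' v` and `d = -ρ w + N' v`, supplies these coordinates.
  let y : ZMod g × (Fin k → ZMod (k + 2 + n)) × ZMod (N' * a) := (τ, 0, b')
  let d : ZMod g × (Fin k → ZMod (k + 2 + n)) × ZMod (N' * a) := (-ρ, 0, N')
  -- The last index is the root; the one before it is forced by `∑ x_i = (k+2) y - d`.
  let x : Fin (k + 2) → ZMod g × (Fin k → ZMod (k + 2 + n)) × ZMod (N' * a) :=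
    Fin.snoc (Fin.snoc e ((k + 2) • y - d - ∑ i, e i) : Fin (k + 1) → _) 0
  have hxe : ∀ i : Fin k, x i.castSucc.castSucc = e i := fun i => by simp [x]
  have hxk : x (Fin.last k).castSucc = (k + 2) • y - d - ∑ i, e i := by simp [x]
  have hxl : x (Fin.last (k + 1)) = 0 := by simp [x]
  have hx : ∑ i, x i = (k + 2) • y - d := by
    rw [Fin.sum_univ_castSucc, Fin.sum_univ_castSucc, hxl, hxk]
    simp_rw [hxe]
    abel
  have hNs : ∀ z : ZMod g × (Fin k → ZMod (k + 2 + n)) × ZMod (N' * a),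
      (k + 2 + n) • z = (g * N') • z := fun z => congrArg (· • z) hN
  have hNz : (k + 2 + n : ZMod (k + 2 + n)) = 0 := by
    exact_mod_cast ZMod.natCast_self (k + 2 + n)
  have hrel : (k + 2 + n) • y = (1 - seqT (k + 2) n) • d := by
    rw [hNs, hT]
    ext
    · simp [y, d]
    · simp [y, d]
    · simp [y, d]
      ring
  have hNe : ∀ i, (k + 2 + n) • e i = 0 := by
    intro i
    ext j
    · simp [e]
    · simp [e, hNz]
    · simp [e]
  have hNx : ∀ i, (k + 2 + n) • x i = 0 := by
    intro i
    induction i using Fin.lastCases with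
    | last => rw [hxl, smul_zero]
    | cast i =>
      induction i using Fin.lastCases with
      | last =>
        rw [hxk, smul_sub, smul_sum, sum_eq_zero fun i _ => hNe i, sub_zero, hNs]
        ext
        · simp [y, d]
        · simp [y, d]
        · simp [y, d]
          linear_combination -hMz
      | cast i => rw [hxe, hNe]
  have hbezg : (ρ * b' + τ * N' : ZMod g) = 1 := by
    simpa using congrArg (Int.cast : ℤ → ZMod g) hbez
  have hbezM : (ρ * b' + τ * N' : ZMod (N' * a)) = 1 := by
    simpa using congrArg (Int.cast : ℤ → ZMod (N' * a)) hbez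
  refine nonempty_criticalGroup_addEquiv (r := Sum.inl (Fin.last (k + 1)))
    (φ := Sum.elim x fun j : Fin n => y + seqS (k + 2) j • d) hxl
    (isHarmonic_elim hx hNx hrel) ?_ ?_ u v
  · set H := AddSubgroup.closure
      (Set.range (Sum.elim x fun j : Fin n => y + seqS (k + 2) j • d))
    have hxH : ∀ i, x i ∈ H := fun i => AddSubgroup.subset_closure ⟨Sum.inl i, rfl⟩
    have hyH : y ∈ H := AddSubgroup.subset_closure ⟨Sum.inr ⟨0, hn⟩, by simp⟩
    have hdH : d ∈ H := by
      have : d = (k + 2) • y - ∑ i, x i := by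
        rw [hx]
        abel
      rw [this]
      exact sub_mem (nsmul_mem hyH _) (sum_mem fun i _ => hxH i)
    rw [eq_top_iff]
    rintro ⟨p, q, t⟩ -
    obtain ⟨p, rfl⟩ := ZMod.intCast_surjective p
    obtain ⟨t, rfl⟩ := ZMod.intCast_surjective t
    choose q' hq' using fun i => ZMod.intCast_surjective (q i)
    have hsum : ((p : ZMod g), q, (t : ZMod (N' * a))) =
        p • (N' • y - b' • d) + ∑ i, q' i • x i.castSucc.castSucc + t • (τ • d + ρ • y) := by
      simp_rw [hxe]
      refine Prod.ext ?_ (Prod.ext ?_ ?_)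
      · simp [y, d, e, Prod.fst_sum]
        linear_combination (-p : ZMod g) * hbezg
      · ext i
        simp [y, d, e, Prod.fst_sum, Prod.snd_sum, Finset.sum_apply, Pi.single_apply, hq']
      · simp [y, d, e, Prod.snd_sum]
        linear_combination (-t : ZMod (N' * a)) * hbezM
    rw [hsum]
    exact add_mem (add_mem (zsmul_mem (sub_mem (nsmul_mem hyH _) (zsmul_mem hdH _)) _)
      (sum_mem fun i _ => zsmul_mem (hxH _) _))
      (zsmul_mem (add_mem (zsmul_mem hdH _) (zsmul_mem hyH _)) _)
  · intro B _ f h₀ hf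
    obtain ⟨Y, hY⟩ : ∃ Y, Y = f (Sum.inr ⟨0, hn⟩) := ⟨_, rfl⟩
    obtain ⟨D, hD⟩ : ∃ D, D = (k + 2) • Y - ∑ i, f (Sum.inl i) := ⟨_, rfl⟩
    obtain ⟨h1, h2, h3⟩ := hf.completeJoinPath_relations hn h₀ hY hD
    have hw : g • (N' • Y - b' • D) = 0 := by
      rw [hN, hT] at h3
      rw [smul_sub, smul_smul, h3, mul_smul, natCast_zsmul, sub_self]
    have haD : a • D = 0 := by
      have hX : (k + 2 + n) • ∑ i, f (Sum.inl i) = 0 := by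
        rw [smul_sum]
        exact sum_eq_zero fun i _ => h1 i
      have hX' : ∑ i, f (Sum.inl i) = (k + 2) • Y - D := by
        rw [hD]
        abel
      rw [hX', smul_sub, smul_comm, h3, hT, hN, ← natCast_zsmul D, ← natCast_zsmul _ (k + 2),
        smul_smul, ← sub_smul] at hX
      rw [← natCast_zsmul, haT, ← neg_eq_zero, ← neg_smul, ← hX]
      congr 1
      push_cast
      ring
    have hv : (N' * a) • (τ • D + ρ • Y) = 0 := by
      have h4 : (N' * a) • (τ • D + ρ • Y) =
          (N' * τ) • (a • D) + (ρ * (N' - (k + 2) * b')) • (g • (N' • Y - b' • D))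
          + (ρ * b') • (a • D) := by
        simp only [← natCast_zsmul, haT, smul_add, smul_sub, smul_smul, Nat.cast_mul]
        module
      rw [h4, hw, haD]
      simp
    refine ⟨(zmodHom g _ hw).coprod ((∑ i, (zmodHom (k + 2 + n) _ (h1 i.castSucc.castSucc)).comp
      (Pi.evalAddMonoidHom _ i)).coprod (zmodHom (N' * a) _ hv)), ?_⟩
    set ψ := (zmodHom g _ hw).coprod ((∑ i : Fin k,
      (zmodHom (k + 2 + n) _ (h1 i.castSucc.castSucc)).comp
      (Pi.evalAddMonoidHom (fun _ => ZMod (k + 2 + n)) i)).coprod (zmodHom (N' * a) _ hv)) with hψ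
    have hψe : ∀ i, ψ (e i) = f (Sum.inl i.castSucc.castSucc) := by
      intro i
      simp only [hψ, e, AddMonoidHom.coprod_apply, map_zero, zero_add, add_zero,
        AddMonoidHom.finsetSum_apply, AddMonoidHom.comp_apply, Pi.evalAddMonoidHom_apply]
      rw [sum_eq_single_of_mem i (mem_univ i)]
      · simp
      · intro j _ hj
        simp [Pi.single_eq_of_ne hj]
    have hψy : ψ y = Y := by
      simp only [hψ, y, AddMonoidHom.coprod_apply, map_zero, zero_add, zmodHom_intCast]
      have : Y = (ρ * b' + τ * N') • Y := by rw [hbez, one_smul]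
      conv_rhs => rw [this]
      simp only [← natCast_zsmul]
      module
    have hψd : ψ d = D := by
      have h5 : d = (((-ρ : ℤ) : ZMod g), 0, ((N' : ℤ) : ZMod (N' * a))) := by simp [d]
      rw [h5]
      simp only [hψ, AddMonoidHom.coprod_apply, map_zero, zero_add, zmodHom_intCast]
      have : D = (ρ * b' + τ * N') • D := by rw [hbez, one_smul]
      conv_rhs => rw [this]
      simp only [← natCast_zsmul]
      module
    rintro (i | j)
    · rw [Sum.elim_inl]
      induction i using Fin.lastCases with
      | last => rw [hxl, map_zero, h₀]
      | cast i =>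
        induction i using Fin.lastCases with
        | last =>
          rw [hxk, map_sub, map_sub, map_nsmul, map_sum, hψy, hψd]
          simp_rw [hψe]
          rw [hD, Fin.sum_univ_castSucc, Fin.sum_univ_castSucc, h₀]
          abel
        | cast i => rw [hxe, hψe]
    · rw [Sum.elim_inr, map_add, map_zsmul, hψy, hψd, h2 j]

end Presentation

/-! ### Identifying the gcd, and counting trees -/

section Main

/-- Since `a = (m+n) - m(1-T)` and `b ≡ (1-T) - a` modulo `m+n`, the triple `m+n`, `a`, `b` has the
same common divisors as the pair `m+n`, `1-T`. -/
lemma exists_bezout_of_gcd {m n a b : ℕ} (hm : 0 < m) (ha : (a : ℤ) = seqA m n)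
    (hb : (b : ℤ) = seqB m n) :
    ∃ (N' : ℕ) (b' ρ τ : ℤ), m + n = Nat.gcd (m + n) (Nat.gcd a b) * N' ∧
      1 - seqT m n = Nat.gcd (m + n) (Nat.gcd a b) * b' ∧ ρ * b' + τ * N' = 1 := by
  set g := Nat.gcd (m + n) (Nat.gcd a b) with hg
  have hgN : g ∣ m + n := Nat.gcd_dvd_left _ _
  have hga : g ∣ a := (Nat.gcd_dvd_right _ _).trans (Nat.gcd_dvd_left _ _)
  have hgb : g ∣ b := (Nat.gcd_dvd_right _ _).trans (Nat.gcd_dvd_right _ _)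
  have hA := seqA_eq m n
  have hB : 1 - seqT m n = seqB m n - (m + n : ℕ) * seqS m (n - 1) + seqA m n := by
    rw [seqB, hA]
    push_cast
    ring
  have hgT : (g : ℤ) ∣ 1 - seqT m n := by
    rw [hB, ← ha, ← hb]
    exact dvd_add (dvd_sub (Int.natCast_dvd_natCast.2 hgb)
      ((Int.natCast_dvd_natCast.2 hgN).mul_right _)) (Int.natCast_dvd_natCast.2 hga)
  have hgcd : Int.gcd (1 - seqT m n) (m + n : ℕ) ∣ g := by
    set h := Int.gcd (1 - seqT m n) (m + n : ℕ)
    have h1 : (h : ℤ) ∣ 1 - seqT m n := Int.gcd_dvd_left _ _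
    have h2 : (h : ℤ) ∣ (m + n : ℕ) := Int.gcd_dvd_right _ _
    have h3 : (h : ℤ) ∣ a := by
      have : (a : ℤ) = (m + n : ℕ) - m * (1 - seqT m n) := by
        rw [ha, hA]
        push_cast
        ring
      rw [this]
      exact dvd_sub h2 (h1.mul_left _)
    have h4 : (h : ℤ) ∣ b := by
      have : (b : ℤ) = (1 - seqT m n) + (m + n : ℕ) * seqS m (n - 1) - a := by
        rw [hB, ha, hb]
        ring
      rw [this]
      exact dvd_sub (dvd_add h1 (h2.mul_right _)) h3
    exact Nat.dvd_gcd (Int.natCast_dvd_natCast.1 h2)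
      (Nat.dvd_gcd (Int.natCast_dvd_natCast.1 h3) (Int.natCast_dvd_natCast.1 h4))
  obtain ⟨N', hN'⟩ := hgN
  obtain ⟨b', hb'⟩ := hgT
  obtain ⟨q, hq⟩ := hgcd
  have hg0 : (g : ℤ) ≠ 0 := by
    have : 0 < g := Nat.gcd_pos_of_pos_left _ (by omega)
    exact_mod_cast this.ne'
  -- Scaling by `q` turns the Bézout identity for the pair's gcd into one for `g`, which then
  -- cancels.
  refine ⟨N', b', Int.gcdA (1 - seqT m n) (m + n : ℕ) * q,
    Int.gcdB (1 - seqT m n) (m + n : ℕ) * q, hN', hb', ?_⟩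
  have hbez := Int.gcd_eq_gcd_ab (1 - seqT m n) (m + n : ℕ)
  have hq' : (g : ℤ) = Int.gcd (1 - seqT m n) (m + n : ℕ) * q := by exact_mod_cast hq
  have hNz : ((m + n : ℕ) : ℤ) = g * N' := by exact_mod_cast hN'
  refine mul_left_cancel₀ hg0 ?_
  linear_combination (-q : ℤ) * hbez - hq' -
    q * Int.gcdA (1 - seqT m n) (m + n : ℕ) * hb' - q * Int.gcdB (1 - seqT m n) (m + n : ℕ) * hNz

/-- The critical group of `K_m ∨ P_n` in terms of the sequences `a_n` and `b_n`. -/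
theorem nonempty_criticalGroup_addEquiv_of_seq {m n a b : ℕ} (hm : 2 ≤ m) (hn : 0 < n)
    (ha : (a : ℤ) = seqA m n) (hb : (b : ℤ) = seqB m n) (u v : Fin m ⊕ Fin n) :
    Nonempty (CriticalGroup (completeJoinPath m n) u v ≃+
      ZMod (Nat.gcd (m + n) (Nat.gcd a b)) × (Fin (m - 2) → ZMod (m + n)) ×
        ZMod ((m + n) * a / Nat.gcd (m + n) (Nat.gcd a b))) := by
  obtain ⟨N', b', ρ, τ, hN, hT, hbez⟩ := exists_bezout_of_gcd (by omega) ha hb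
  have hg : 0 < Nat.gcd (m + n) (Nat.gcd a b) := Nat.gcd_pos_of_pos_left _ (by omega)
  have hdiv : (m + n) * a / Nat.gcd (m + n) (Nat.gcd a b) = N' * a := by
    refine Nat.div_eq_of_eq_mul_right hg ?_
    rw [← mul_assoc, ← hN]
  rw [hdiv]
  obtain ⟨k, rfl⟩ := Nat.exists_eq_add_of_le' hm
  exact nonempty_criticalGroup_completeJoinPath_addEquiv hn hN hT ha hbez u v

/-- In the product of the orders of the cyclic factors, `g` cancels; the fan `m = 1` is treated
separately. -/
lemma spanningTreeCount_completeJoinPath {m n : ℕ} (hm : 0 < m) (hn : 0 < n) :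
    (spanningTreeCount (completeJoinPath m n) : ℤ) = (m + n) ^ (m - 1) * seqA m n := by
  obtain ⟨a, ha⟩ := Int.eq_ofNat_of_zero_le (seqP_pos_and_seqA_nonneg m n).2
  obtain ⟨b, hb⟩ := Int.eq_ofNat_of_zero_le (seqB_nonneg hm hn)
  rw [spanningTreeCount_eq_card_criticalGroup (completeJoinPath_connected hm hn)
    (Sum.inl ⟨0, hm⟩), ha]
  norm_cast
  obtain rfl | hm2 : m = 1 ∨ 2 ≤ m := by omega
  · obtain ⟨E⟩ := nonempty_criticalGroup_fan_addEquiv hn ha.symm (Sum.inl ⟨0, hm⟩)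
      (Sum.inl ⟨0, hm⟩)
    rw [Nat.card_congr E.toEquiv, Nat.card_zmod]
    simp
  · obtain ⟨E⟩ := nonempty_criticalGroup_addEquiv_of_seq hm2 hn ha.symm hb.symm
      (Sum.inl ⟨0, hm⟩) (Sum.inl ⟨0, hm⟩)
    rw [Nat.card_congr E.toEquiv, Nat.card_prod, Nat.card_prod, Nat.card_fun, Nat.card_zmod,
      Nat.card_zmod, Nat.card_zmod, Nat.card_fin, mul_left_comm, Nat.mul_div_cancel'
        ((Nat.gcd_dvd_left _ _).mul_right a), ← mul_assoc, ← pow_succ]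
    congr 2
    omega

end Main

end JoinCritical

theorem theorem2p3 (m n : ℕ) (hn : 4 ≤ n) :
    (1 ≤ m →
      (JoinCritical.spanningTreeCount (JoinCritical.completeJoinPath m n) : ℝ) =
        ((m : ℝ) + n) ^ (m - 1) / ((2 : ℝ) ^ n * √((m : ℝ) ^ 2 + 4 * m)) *
          (((m : ℝ) + 2 + √((m : ℝ) ^ 2 + 4 * m)) ^ n -
            ((m : ℝ) + 2 - √((m : ℝ) ^ 2 + 4 * m)) ^ n)) ∧
    (2 ≤ m →
      ∃ a b : ℕ, (a : ℝ) = JoinCritical.paramA m n ∧ (b : ℝ) = JoinCritical.paramB m n ∧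
        ∀ u v : Fin m ⊕ Fin n,
          Nonempty (JoinCritical.CriticalGroup (JoinCritical.completeJoinPath m n) u v ≃+
            ZMod (Nat.gcd (m + n) (Nat.gcd a b)) ×
              (Fin (m - 2) → ZMod (m + n)) ×
              ZMod ((m + n) * a / Nat.gcd (m + n) (Nat.gcd a b)))) := by
  have hn0 : 0 < n := by omega
  refine ⟨fun hm => ?_, fun hm => ?_⟩
  · have hcount : (JoinCritical.spanningTreeCount (JoinCritical.completeJoinPath m n) : ℝ) =
        ((m : ℝ) + n) ^ (m - 1) * JoinCritical.seqA m n := by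
      exact_mod_cast JoinCritical.spanningTreeCount_completeJoinPath hm hn0
    rw [hcount, JoinCritical.seqA_eq_paramA hm, JoinCritical.paramA, div_pow, div_pow, ← sub_div,
      JoinCritical.disc]
    have hD := (JoinCritical.disc_pos hm).ne'
    rw [JoinCritical.disc] at hD
    field_simp
  · have hm0 : 0 < m := by omega
    obtain ⟨a, ha⟩ := Int.eq_ofNat_of_zero_le (JoinCritical.seqP_pos_and_seqA_nonneg m n).2
    obtain ⟨b, hb⟩ := Int.eq_ofNat_of_zero_le (JoinCritical.seqB_nonneg hm0 hn0)
    refine ⟨a, b, ?_, ?_, JoinCritical.nonempty_criticalGroup_addEquiv_of_seq hm hn0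
      ha.symm hb.symm⟩
    · rw [← JoinCritical.seqA_eq_paramA hm0, ha, Int.cast_natCast]
    · rw [← JoinCritical.seqB_eq_paramB hm0 hn0, hb, Int.cast_natCast]
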